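/- For every integer $j\ge 0$ there is a constant $C_j>0$ such that the following holds. Let $X$ be a finite set, $Y$ a finite abelian group with $|Y|=N$, and $i\ge 1$. Consider any quantum algorithm that makes $i$ queries to a function $f:X\to Y$, i.e. it has a query register over $X$, a response register over $Y$ and a private register over an arbitrary finite set $Z$, starts in an arbitrary unit vector of $\mathbb{C}^{X\times Y\times Z}$ independent of $f$, applies $i$ times the query unitary $|x,y,z\rangle\mapsto|x,y+f(x),z\rangle$, each time followed by an arbitrary unitary on all registers that does not depend on $f$, and finally measures all registers in the computational basis and computes its output, a finite set of unordered pairs of elements of $X$, from the measurement result. A $2$-collision of $f$ is an unordered pair $\{x,x'\}$ with $x\ne x'$ and $f(x)=f(x')$. If $f:X\to Y$ is chosen uniformly at random, then the probability that the algorithm outputs a set of exactly $j$ distinct $2$-collisions of $f$, none of which is implied by the others (that is, the graph on $X$ whose edges are these $j$ pairs contains no cycle; this holds in particular if the $j$ collisions are pairwise disjoint or have distinct images), is at most $$C_j\left(\frac{i^3}{N}\right)^{j}.$$ -/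

import Mathlib

universe u v w

/-- The pure-state space of a quantum query algorithm with query register `X`, response register `Y`
and private register `Z`: the Hilbert space with orthonormal computational basis `|x, y, z⟩`. -/
abbrev QState (X : Type u) (Y : Type v) (Z : Type w) [Fintype X] [Fintype Y] [Fintype Z] :=
  EuclideanSpace ℂ (X × Y × Z)

/-- The permutation `(x, y, z) ↦ (x, y + f x, z)` of the computational basis. -/
def queryPerm {X : Type u} {Y : Type v} (Z : Type w) [AddCommGroup Y] (f : X → Y) :
    Equiv.Perm (X × Y × Z) where
  toFun b := (b.1, b.2.1 + f b.1, b.2.2)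
  invFun b := (b.1, b.2.1 - f b.1, b.2.2)
  left_inv b := by simp
  right_inv b := by simp

/-- One quantum query to `f`: the unitary `|x, y, z⟩ ↦ |x, y + f x, z⟩`. -/
noncomputable def queryOracle {X : Type u} {Y : Type v} (Z : Type w) [Fintype X] [Fintype Y]
    [Fintype Z] [AddCommGroup Y] (f : X → Y) : QState X Y Z ≃ₗᵢ[ℂ] QState X Y Z :=
  LinearIsometryEquiv.piLpCongrLeft 2 ℂ ℂ (queryPerm Z f)

/-- The action of a query on the computational basis. -/
theorem queryOracle_single {X : Type u} {Y : Type v} {Z : Type w} [Fintype X] [Fintype Y]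
    [Fintype Z] [DecidableEq X] [DecidableEq Y] [DecidableEq Z] [AddCommGroup Y] (f : X → Y)
    (x : X) (y : Y) (z : Z) :
    queryOracle Z f (EuclideanSpace.single (x, y, z) (1 : ℂ)) =
      EuclideanSpace.single (x, y + f x, z) (1 : ℂ) := by
  simp [queryOracle, queryPerm, EuclideanSpace.single]

/-- A quantum algorithm with oracle access to a function `X → Y`, private register `Z` and outputs
in `O`. It starts in the unit vector `init`, applies the unitary `step k` (on all of its registers)
after its query number `k` (counted from `0`), and at the end measures all of its registers in the
computational basis and outputs `output b` on the measurement result `b`. -/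
structure QueryAlgorithm (X : Type u) (Y : Type v) (Z : Type w) (O : Type*)
    [Fintype X] [Fintype Y] [Fintype Z] where
  init : QState X Y Z
  norm_init : ‖init‖ = 1
  step : ℕ → (QState X Y Z ≃ₗᵢ[ℂ] QState X Y Z)
  output : X × Y × Z → O

namespace QueryAlgorithm

variable {X : Type u} {Y : Type v} {Z : Type w} {O : Type*}
  [Fintype X] [Fintype Y] [Fintype Z] [AddCommGroup Y]

/-- The state of the algorithm run with oracle `f`, after `i` queries (each followed by the
corresponding unitary of the algorithm). -/
noncomputable def state (A : QueryAlgorithm X Y Z O) (f : X → Y) : ℕ → QState X Y Z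
  | 0 => A.init
  | i + 1 => A.step i (queryOracle Z f (A.state f i))

open scoped Classical in
/-- The probability that the algorithm, run with oracle `f` and `i` queries, outputs an element
of the set `S`. -/
noncomputable def outputProb (A : QueryAlgorithm X Y Z O) (i : ℕ) (f : X → Y) (S : Set O) : ℝ :=
  ∑ b : X × Y × Z, if A.output b ∈ S then ‖A.state f i b‖ ^ 2 else 0

/-- The probability, over a uniformly random function `f : X → Y` and the measurement, that the
algorithm with `i` queries to `f` outputs some `o` with `R f o`. -/
noncomputable def successProb [DecidableEq X] (A : QueryAlgorithm X Y Z O) (i : ℕ)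
    (R : (X → Y) → O → Prop) : ℝ :=
  (∑ f : X → Y, A.outputProb i f {o | R f o}) / Fintype.card (X → Y)

end QueryAlgorithm

/-- A `2`-collision of `f`: an unordered pair of distinct inputs with the same image. -/
def IsTwoCollision {X : Type u} {Y : Type v} (f : X → Y) (e : Sym2 X) : Prop :=
  ∃ x x' : X, x ≠ x' ∧ f x = f x' ∧ e = s(x, x')

/-- `E` consists of exactly `j` distinct `2`-collisions of `f`, none of which is forced by the
others: the graph on the inputs with edge set `E` has no cycle. (For example, the three pairs inside
a triple of inputs with a common image are not allowed, as any two of them imply the third one.)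
This holds for any `j` pairwise disjoint `2`-collisions, in particular for `j` `2`-collisions with
distinct images. -/
def IsTwoCollisionFamily {X : Type u} {Y : Type v} (j : ℕ) (f : X → Y)
    (E : Finset (Sym2 X)) : Prop :=
  E.card = j ∧ (∀ e ∈ E, IsTwoCollision f e) ∧
    (SimpleGraph.fromEdgeSet (E : Set (Sym2 X))).IsAcyclic

/-! The proof is by the compressed oracle method. A uniformly random `f` may be replaced by
registers, one per input, in uniform superposition over `Y`. With an extra basis vector `none`, the
reflection exchanging `none` with the uniform superposition turns them into a database `X → Option
Y`, initially empty. Reflections at inputs other than `x` commute with a query at `x`, so a query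
becomes: reflect at `x`, query, reflect at `x` (`dbReflList_dbState`). After `i` queries the
database has at most `2 * i` entries.

Progress is measured by `dbRank`, the number of entries minus the number of distinct values. A
reflection at `x` raises it only by giving `x` one of the at most `s` values held by other entries,
each with an amplitude of order `1 / √N`. Hence the norm at rank at least `j + 1` grows by at most
`√(2 * s / N)` times the norm at rank at least `j` (`collNorm_succ_ctrlRefl_le`), and after `t ≤ T`
reflections the norm at rank at least `j` is at most `(t * √(2 * T / N)) ^ j`.

An output forest with `j` edges has at most `2 * j` vertices. Reflecting at these alone decides
whether it is correct (`sum_isRecorded_le`), and a correct one forces rank at least `j`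
(`le_dbRank_of_isAcyclic`). With `T = 2 * i + 2 * j`, squaring gives `(2 * T ^ 3 / N) ^ j`. -/

/-- A function that is constant along the edges of a forest has at most as many values as the
forest has components. -/
theorem card_add_card_image_le_of_isAcyclic {X : Type u} [Fintype X] [DecidableEq X]
    (E : Finset (Sym2 X)) :
    ∀ {S : Type v} [DecidableEq S] (h : X → S), (∀ e ∈ E, ¬ e.IsDiag) →
      (SimpleGraph.fromEdgeSet (E : Set (Sym2 X))).IsAcyclic →
      (∀ a b, s(a, b) ∈ E → h a = h b) →
      E.card + (Finset.univ.image h).card ≤ Fintype.card X := by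
  classical
  induction E using Finset.induction_on with
  | empty =>
    intro S _ h _ _ _
    simpa using Finset.card_image_le (s := Finset.univ) (f := h)
  | insert e E he ih =>
    intro S _ h hd hac hh
    induction e with
    | _ a b =>
    have hab : a ≠ b := by simpa using hd _ (Finset.mem_insert_self _ _)
    set G := SimpleGraph.fromEdgeSet (E : Set (Sym2 X)) with hG
    have hle : G ≤ SimpleGraph.fromEdgeSet ((insert s(a, b) E : Finset _) : Set (Sym2 X)) :=
      SimpleGraph.fromEdgeSet_mono (by simp)
    -- In a forest every edge is a bridge, so removing it separates its ends.
    have hnr : ¬ G.Reachable a b := by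
      have h1 := SimpleGraph.isAcyclic_iff_forall_isBridge.1 hac (e := s(a, b)) (by simp [hab])
      rw [SimpleGraph.isBridge_iff] at h1
      refine fun h2 => h1 (h2.mono ?_)
      intro x y hxy
      simp only [hG, SimpleGraph.fromEdgeSet_adj, Finset.mem_coe] at hxy
      simp only [SimpleGraph.deleteEdges_adj, SimpleGraph.fromEdgeSet_adj, Finset.coe_insert,
        Set.mem_insert_iff, Finset.mem_coe, Set.mem_singleton_iff]
      exact ⟨⟨Or.inr hxy.1, hxy.2⟩, fun h3 => he (h3 ▸ hxy.1)⟩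
    -- Recording also whether a vertex lies in the component of `a` separates `a` from `b`, which
    -- have the same `h`, so the refined map has at least one more value.
    have key := ih (S := S × Bool) (fun x => (h x, decide (G.Reachable a x)))
      (fun e he => hd e (Finset.mem_insert_of_mem he)) (hac.anti hle) (by
        intro x y hxy
        have hne : x ≠ y := by simpa using hd _ (Finset.mem_insert_of_mem hxy)
        have hadj : G.Adj x y := by simp [hG, hxy, hne]
        have : G.Reachable a x ↔ G.Reachable a y :=
          ⟨fun h => h.trans hadj.reachable, fun h => h.trans hadj.symm.reachable⟩
        simp [hh x y (Finset.mem_insert_of_mem hxy), this])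
    have himg : Finset.univ.image h =
        (Finset.univ.image fun x => (h x, decide (G.Reachable a x))).image Prod.fst := by
      rw [Finset.image_image]; rfl
    have hlt : (Finset.univ.image h).card <
        (Finset.univ.image fun x => (h x, decide (G.Reachable a x))).card := by
      rw [himg]
      refine lt_of_le_of_ne Finset.card_image_le fun hcard => ?_
      have hinj := Finset.card_image_iff.1 hcard
      have h3 := @hinj (h a, decide (G.Reachable a a))
        (Finset.mem_coe.2 (Finset.mem_image_of_mem _ (Finset.mem_univ a)))
        (h b, decide (G.Reachable a b))
        (Finset.mem_coe.2 (Finset.mem_image_of_mem _ (Finset.mem_univ b)))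
        (hh a b (Finset.mem_insert_self _ _))
      simp [hnr] at h3
    rw [Finset.card_insert_of_notMem he]
    omega

/-! ### Databases and their collision rank -/

section Database

variable {X : Type u} {Y : Type v} [Fintype X] [DecidableEq X]

/-- The inputs at which a partial function is defined. -/
def dbDom (D : X → Option Y) : Finset X := Finset.univ.filter fun x => D x ≠ none

theorem dbDom_update_some (D : X → Option Y) (x : X) (y : Y) :
    dbDom (Function.update D x (some y)) = insert x (dbDom D) := by
  ext a
  by_cases h : a = x <;> simp [dbDom, Function.update_apply, h]

theorem card_dbDom_update_some {D : X → Option Y} {x : X} (hx : D x = none) (y : Y) :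
    (dbDom (Function.update D x (some y))).card = (dbDom D).card + 1 := by
  rw [dbDom_update_some, Finset.card_insert_of_notMem (by simp [dbDom, hx])]

theorem card_dbDom_le_update {D : X → Option Y} {x : X} (hx : D x = none) (o : Option Y) :
    (dbDom D).card ≤ (dbDom (Function.update D x o)).card := by
  cases o with
  | none => rw [← hx, Function.update_eq_self]
  | some y => rw [card_dbDom_update_some hx]; omega

theorem card_dbDom_update_le {D : X → Option Y} {x : X} (hx : D x = none) (o : Option Y) :
    (dbDom (Function.update D x o)).card ≤ (dbDom D).card + 1 := by
  cases o with
  | none => rw [← hx, Function.update_eq_self]; omega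
  | some y => rw [card_dbDom_update_some hx]

/-- Splits the databases into slices along the entry at `x`. A reflection at `x` acts on each slice
separately. -/
theorem sum_database_eq [Fintype Y] {M : Type*} [AddCommMonoid M] (x : X) (h : (X → Option Y) → M) :
    ∑ D, h D = ∑ D : X → Option Y, if D x = none then ∑ o, h (Function.update D x o) else 0 := by
  rw [← Finset.sum_filter, Finset.sum_sigma']
  symm
  refine Finset.sum_bij' (fun p _ => Function.update p.1 x p.2)
    (fun D _ => ⟨Function.update D x none, D x⟩) ?_ ?_ ?_ ?_ ?_
  · simp
  · simp
  · rintro ⟨D, o⟩ h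
    simp only [Finset.mem_sigma, Finset.mem_filter, Finset.mem_univ, true_and, and_true] at h
    simp [← h]
  · simp
  · simp

variable [DecidableEq Y]

/-- The number of independent collisions in a partial function. -/
def dbRank (D : X → Option Y) : ℕ := (dbDom D).card - ((dbDom D).image D).card

theorem le_dbRank_of_isAcyclic (D : X → Option Y) (E : Finset (Sym2 X))
    (hd : ∀ e ∈ E, ¬ e.IsDiag)
    (hac : (SimpleGraph.fromEdgeSet (E : Set (Sym2 X))).IsAcyclic)
    (hE : ∀ a b, s(a, b) ∈ E → D a = D b ∧ D a ≠ none) : E.card ≤ dbRank D := by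
  classical
  -- Each undefined input receives a private value, so that these inputs contribute equally to both
  -- sides and cancel.
  have key := card_add_card_image_le_of_isAcyclic E
    (fun x => if D x = none then (Sum.inr x : Option Y ⊕ X) else Sum.inl (D x)) hd hac (by
      intro a b hab
      obtain ⟨h1, h2⟩ := hE a b hab
      simp [← h1, h2])
  have himg : (Finset.univ.image
      (fun x => if D x = none then (Sum.inr x : Option Y ⊕ X) else Sum.inl (D x))) =
      ((dbDom D).image D).disjSum (dbDom D)ᶜ := by
    ext a
    rcases a with a | a
    · simp only [Finset.mem_image, Finset.mem_univ, true_and, Finset.inl_mem_disjSum, dbDom,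
        Finset.mem_filter]
      refine exists_congr fun x => ?_
      by_cases h : D x = none <;> simp [h]
    · simp only [Finset.mem_image, Finset.mem_univ, true_and, Finset.inr_mem_disjSum, dbDom,
        Finset.mem_filter, Finset.mem_compl, not_not]
      constructor
      · rintro ⟨x, hx⟩
        by_cases h : D x = none
        · simp only [h, if_true, Sum.inr.injEq] at hx
          exact hx ▸ h
        · simp [h] at hx
      · exact fun h => ⟨a, by simp [h]⟩
  rw [himg, Finset.card_disjSum, Finset.card_compl] at key
  have h1 := Finset.card_le_univ (dbDom D)
  unfold dbRank
  omega

theorem image_dbDom_update_some {D : X → Option Y} {x : X} (hx : D x = none) (y : Y) :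
    (dbDom (Function.update D x (some y))).image (Function.update D x (some y)) =
      insert (some y) ((dbDom D).image D) := by
  rw [dbDom_update_some, Finset.image_insert, Function.update_self]
  congr 1
  refine Finset.image_congr fun a ha => ?_
  have : a ≠ x := by rintro rfl; simp [dbDom, hx] at ha
  simp [this]

theorem dbRank_update_some {D : X → Option Y} {x : X} (hx : D x = none) (y : Y) :
    dbRank (Function.update D x (some y)) =
      if some y ∈ (dbDom D).image D then dbRank D + 1 else dbRank D := by
  have h := Finset.card_image_le (s := dbDom D) (f := D)
  unfold dbRank
  rw [card_dbDom_update_some hx, image_dbDom_update_some hx]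
  split_ifs with hy
  · rw [Finset.insert_eq_of_mem hy]; omega
  · rw [Finset.card_insert_of_notMem hy]; omega

theorem dbRank_le_update {D : X → Option Y} {x : X} (hx : D x = none) (o : Option Y) :
    dbRank D ≤ dbRank (Function.update D x o) := by
  cases o with
  | none => rw [← hx, Function.update_eq_self]
  | some y => rw [dbRank_update_some hx]; split_ifs <;> omega

end Database

/-! ### Reflections that compress and decompress the oracle -/

section Reflection

variable {X : Type u} {Y : Type v} [DecidableEq X] [Fintype Y]
variable {V : Type*} [AddCommGroup V] [Module ℂ V] {W : Type*} [AddCommGroup W] [Module ℂ W]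

/-- The difference of the vector `none` and the uniform superposition of the vectors `some y`. -/
noncomputable def reflVec (Y : Type v) [Fintype Y] : Option Y → ℝ
  | none => 1
  | some _ => -(1 / √(Fintype.card Y))

/-- The reflection that exchanges `none` with the uniform superposition of the vectors `some y`,
applied to the value of the database at `x`. -/
noncomputable def dbRefl (x : X) (φ : (X → Option Y) → V) : (X → Option Y) → V := fun D =>
  φ D - (reflVec Y (D x) : ℂ) • ∑ o, (reflVec Y o : ℂ) • φ (Function.update D x o)

theorem sum_reflVec_sq [Nonempty Y] : ∑ o, reflVec Y o ^ 2 = 2 := by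
  have h : (0 : ℝ) < Fintype.card Y := by exact_mod_cast Fintype.card_pos
  rw [Fintype.sum_option]
  simp only [reflVec, neg_sq, div_pow, one_pow, Real.sq_sqrt h.le, Finset.sum_const,
    Finset.card_univ, nsmul_eq_mul]
  field_simp
  norm_num

theorem sum_reflVec_mul_self [Nonempty Y] :
    ∑ o, (reflVec Y o : ℂ) * (reflVec Y o : ℂ) = 2 := by
  have := sum_reflVec_sq (Y := Y)
  simp only [sq] at this
  exact_mod_cast this

theorem dbRefl_map (T : V →ₗ[ℂ] W) (x : X) (φ : (X → Option Y) → V) :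
    dbRefl x (fun D => T (φ D)) = fun D => T (dbRefl x φ D) := by
  ext D; simp [dbRefl]

theorem dbRefl_add (x : X) (φ ψ : (X → Option Y) → V) :
    dbRefl x (φ + ψ) = dbRefl x φ + dbRefl x ψ := by
  ext D
  simp only [dbRefl, Pi.add_apply, smul_add, Finset.sum_add_distrib]
  abel

theorem dbRefl_dbRefl [Nonempty Y] (x : X) (φ : (X → Option Y) → V) :
    dbRefl x (dbRefl x φ) = φ := by
  ext D
  simp only [dbRefl, Function.update_self, Function.update_idem, smul_sub,
    Finset.sum_sub_distrib, smul_smul]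
  rw [← Finset.sum_smul]
  simp only [smul_smul, sum_reflVec_mul_self]
  module

theorem dbRefl_comm (x y : X) (φ : (X → Option Y) → V) :
    dbRefl x (dbRefl y φ) = dbRefl y (dbRefl x φ) := by
  rcases eq_or_ne x y with rfl | hxy
  · rfl
  ext D
  simp only [dbRefl, Function.update_of_ne hxy, Function.update_of_ne hxy.symm, smul_sub,
    Finset.sum_sub_distrib, smul_smul, Finset.smul_sum]
  -- The term in which both reflections act is symmetric, since updates at different inputs commute.
  have h : ∑ a, ∑ b, ((reflVec Y (D x) : ℂ) * (reflVec Y a * (reflVec Y (D y) * reflVec Y b))) •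
        φ (Function.update (Function.update D x a) y b) =
      ∑ a, ∑ b, ((reflVec Y (D y) : ℂ) * (reflVec Y a * (reflVec Y (D x) * reflVec Y b))) •
        φ (Function.update (Function.update D y a) x b) := by
    rw [Finset.sum_comm]
    refine Finset.sum_congr rfl fun b _ => Finset.sum_congr rfl fun a _ => ?_
    rw [Function.update_comm hxy]
    congr 1
    ring
  simp only [h]
  abel

/-- A parameter that does not depend on the entry at `x` may be frozen during the reflection. This
lets a query at one input pass the reflections at all others. -/
theorem dbRefl_param (x : X) {ι : Type*} (c : (X → Option Y) → ι)
    (hc : ∀ D o, c (Function.update D x o) = c D) (χ : ι → (X → Option Y) → V) :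
    dbRefl x (fun D => χ (c D) D) = fun D => dbRefl x (χ (c D)) D := by
  ext D; simp [dbRefl, hc]

/-- The reflections of all entries of the list `l`. -/
noncomputable def dbReflList : List X → ((X → Option Y) → V) → (X → Option Y) → V
  | [], φ => φ
  | x :: l, φ => dbReflList l (dbRefl x φ)

theorem dbReflList_append (l l' : List X) (φ : (X → Option Y) → V) :
    dbReflList (l ++ l') φ = dbReflList l' (dbReflList l φ) := by
  induction l generalizing φ with
  | nil => rfl
  | cons x l ih => exact ih _

theorem dbReflList_perm {l l' : List X} (h : l.Perm l') (φ : (X → Option Y) → V) :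
    dbReflList l φ = dbReflList l' φ := by
  induction h generalizing φ with
  | nil => rfl
  | cons x _ ih => exact ih _
  | swap x y l => simp only [dbReflList, dbRefl_comm]
  | trans _ _ ih₁ ih₂ => rw [ih₁, ih₂]

theorem dbReflList_map (T : V →ₗ[ℂ] W) (l : List X) (φ : (X → Option Y) → V) :
    dbReflList l (fun D => T (φ D)) = fun D => T (dbReflList l φ D) := by
  induction l generalizing φ with
  | nil => rfl
  | cons x l ih => simp only [dbReflList, dbRefl_map, ih]

theorem dbReflList_param (l : List X) {ι : Type*} (c : (X → Option Y) → ι)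
    (hc : ∀ x ∈ l, ∀ D o, c (Function.update D x o) = c D) (χ : ι → (X → Option Y) → V) :
    dbReflList l (fun D => χ (c D) D) = fun D => dbReflList l (χ (c D)) D := by
  induction l generalizing χ with
  | nil => rfl
  | cons x l ih =>
    simp only [dbReflList]
    rw [dbRefl_param x c (hc x (by simp)), ih (fun y hy => hc y (by simp [hy]))
      (fun i => dbRefl x (χ i))]

variable [Fintype X]

theorem dbReflList_univ_dbRefl [Nonempty Y] (x : X) (φ : (X → Option Y) → V) :
    dbReflList Finset.univ.toList (dbRefl x φ) = dbReflList (Finset.univ.erase x).toList φ := by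
  have h : (Finset.univ : Finset X).toList.Perm (x :: (Finset.univ.erase x).toList) := by
    have := Finset.toList_insert (Finset.notMem_erase x (Finset.univ : Finset X))
    rwa [Finset.insert_erase (Finset.mem_univ x)] at this
  rw [dbReflList_perm h, dbReflList, dbRefl_dbRefl]

theorem dbReflList_erase_dbRefl (x : X) (φ : (X → Option Y) → V) :
    dbReflList (Finset.univ.erase x).toList (dbRefl x φ) = dbReflList Finset.univ.toList φ := by
  have h : (Finset.univ : Finset X).toList.Perm (x :: (Finset.univ.erase x).toList) := by
    have := Finset.toList_insert (Finset.notMem_erase x (Finset.univ : Finset X))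
    rwa [Finset.insert_erase (Finset.mem_univ x)] at this
  rw [dbReflList_perm h, dbReflList]

/-- The amplitudes of the uniform superposition of the vectors `some y`. -/
noncomputable def uniformVec (Y : Type v) [Fintype Y] : Option Y → ℝ
  | none => 0
  | some _ => 1 / √(Fintype.card Y)

/-- The product vector that is uniform at the entries in `S` and `none` at the other entries. -/
noncomputable def dbProd (S : Finset X) (D : X → Option Y) : ℂ :=
  ∏ x, if x ∈ S then (uniformVec Y (D x) : ℂ) else if D x = none then 1 else 0

theorem dbRefl_dbProd {S : Finset X} {x : X} (hx : x ∉ S) :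
    dbRefl x (dbProd (Y := Y) S) = dbProd (insert x S) := by
  ext D
  have h1 : ∀ (T : Finset X) (D : X → Option Y), dbProd T D =
      (if x ∈ T then (uniformVec Y (D x) : ℂ) else if D x = none then 1 else 0) *
      ∏ y ∈ Finset.univ.erase x,
        if y ∈ T then (uniformVec Y (D y) : ℂ) else if D y = none then 1 else 0 :=
    fun T D => (Finset.mul_prod_erase _ _ (Finset.mem_univ x)).symm
  have h2 : ∀ o, (∏ y ∈ Finset.univ.erase x, if y ∈ S then
        (uniformVec Y (Function.update D x o y) : ℂ)
        else if Function.update D x o y = none then 1 else 0) =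
      ∏ y ∈ Finset.univ.erase x,
        if y ∈ S then (uniformVec Y (D y) : ℂ) else if D y = none then 1 else 0 := fun o =>
    Finset.prod_congr rfl fun y hy => by
      rw [Function.update_of_ne (Finset.ne_of_mem_erase hy)]
  have h3 : (∏ y ∈ Finset.univ.erase x, if y ∈ insert x S then (uniformVec Y (D y) : ℂ)
        else if D y = none then 1 else 0) =
      ∏ y ∈ Finset.univ.erase x,
        if y ∈ S then (uniformVec Y (D y) : ℂ) else if D y = none then 1 else 0 :=
    Finset.prod_congr rfl fun y hy => by
      simp [Finset.mem_insert, Finset.ne_of_mem_erase hy]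
  simp only [dbRefl, h1, h2, h3, hx, Function.update_self, Fintype.sum_option,
    Finset.mem_insert_self, if_true, if_false]
  cases h : D x <;> simp [reflVec, uniformVec]

theorem dbReflList_dbProd (l : List X) (hl : l.Nodup) (S : Finset X) (hS : ∀ x ∈ l, x ∉ S) :
    dbReflList l (dbProd (Y := Y) S) = dbProd (S ∪ l.toFinset) := by
  induction l generalizing S with
  | nil => simp [dbReflList]
  | cons x l ih =>
    rw [List.nodup_cons] at hl
    rw [dbReflList, dbRefl_dbProd (hS x (by simp)), ih hl.2]
    · congr 1; ext; simp
    · intro y hy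
      have : y ≠ x := fun h => hl.1 (h ▸ hy)
      simp [this, hS y (by simp [hy])]

theorem dbReflList_univ_dbProd_empty :
    dbReflList (Finset.univ : Finset X).toList (dbProd (Y := Y) ∅) = dbProd Finset.univ := by
  rw [dbReflList_dbProd _ (Finset.nodup_toList _) _ (by simp)]
  simp

/-! ### Norms -/

/-- The reflecting vector has squared norm `2`, so the cross term `-2 * ‖s‖ ^ 2` cancels the
quadratic term. -/
theorem sum_norm_sq_sub_reflVec [Nonempty Y] (a : Option Y → ℂ) :
    ∑ o, ‖a o - (reflVec Y o : ℂ) • ∑ p, (reflVec Y p : ℂ) • a p‖ ^ 2 = ∑ o, ‖a o‖ ^ 2 := by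
  set s := ∑ p, (reflVec Y p : ℂ) • a p with hs
  have h1 : ∀ o, ‖a o - (reflVec Y o : ℂ) • s‖ ^ 2 =
      ‖a o‖ ^ 2 - 2 * (inner ℝ ((reflVec Y o : ℂ) • a o) s) + reflVec Y o ^ 2 * ‖s‖ ^ 2 := by
    intro o
    rw [norm_sub_sq_real, Complex.coe_smul, Complex.coe_smul, real_inner_smul_right,
      real_inner_smul_left, norm_smul, mul_pow, Real.norm_eq_abs, sq_abs]
  simp only [h1, Finset.sum_add_distrib, Finset.sum_sub_distrib, ← Finset.mul_sum,
    ← Finset.sum_mul, ← sum_inner, ← hs, sum_reflVec_sq, real_inner_self_eq_norm_sq]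
  ring

theorem sum_norm_sq_dbRefl [Nonempty Y] (x : X) (p : (X → Option Y) → Prop) [DecidablePred p]
    (hp : ∀ D o, p (Function.update D x o) ↔ p D) (φ : (X → Option Y) → ℂ) :
    (∑ D, if p D then ‖dbRefl x φ D‖ ^ 2 else 0) = ∑ D, if p D then ‖φ D‖ ^ 2 else 0 := by
  rw [sum_database_eq x, sum_database_eq x (fun D => if p D then ‖φ D‖ ^ 2 else 0)]
  refine Finset.sum_congr rfl fun D _ => ?_
  simp only [hp]
  split_ifs
  · simp only [dbRefl, Function.update_self, Function.update_idem]
    exact sum_norm_sq_sub_reflVec fun o => φ (Function.update D x o)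
  · rfl
  · rfl

theorem sum_norm_sq_dbReflList [Nonempty Y] (l : List X) (p : (X → Option Y) → Prop)
    [DecidablePred p] (hp : ∀ x ∈ l, ∀ D o, p (Function.update D x o) ↔ p D)
    (φ : (X → Option Y) → ℂ) :
    (∑ D, if p D then ‖dbReflList l φ D‖ ^ 2 else 0) = ∑ D, if p D then ‖φ D‖ ^ 2 else 0 := by
  induction l generalizing φ with
  | nil => rfl
  | cons x l ih =>
    rw [dbReflList, ih fun y hy => hp y (by simp [hy]), sum_norm_sq_dbRefl x p (hp x (by simp))]

theorem dbRefl_eq_zero_of_card_lt {φ : (X → Option Y) → V} {s : ℕ}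
    (hφ : ∀ D, s < (dbDom D).card → φ D = 0) (x : X) {D : X → Option Y}
    (hD : s + 1 < (dbDom D).card) : dbRefl x φ D = 0 := by
  have h : ∀ o, φ (Function.update D x o) = 0 := fun o => by
    apply hφ
    have h1 := card_dbDom_update_le (D := Function.update D x none) (x := x) (by simp) (D x)
    have h2 := card_dbDom_le_update (D := Function.update D x none) (x := x) (by simp) o
    simp only [Function.update_idem, Function.update_eq_self] at h1 h2
    omega
  have h0 : φ D = 0 := hφ D (by omega)
  simp [dbRefl, h, h0]

variable [DecidableEq Y]

/-- A reflection creates a new independent collision with small amplitude only. -/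
theorem sum_norm_sq_dbRefl_le [Nonempty Y] {φ : (X → Option Y) → ℂ} {s : ℕ}
    (hφ : ∀ D, s < (dbDom D).card → φ D = 0) (x : X) (j : ℕ) :
    (∑ D, if j + 1 ≤ dbRank D then
        ‖dbRefl x (fun D => if j + 1 ≤ dbRank D then 0 else φ D) D‖ ^ 2 else 0) ≤
      2 * s / Fintype.card Y * ∑ D, if j ≤ dbRank D then ‖φ D‖ ^ 2 else 0 := by
  have hN : (0 : ℝ) < Fintype.card Y := by exact_mod_cast Fintype.card_pos
  rw [sum_database_eq x, sum_database_eq x (fun D => if j ≤ dbRank D then ‖φ D‖ ^ 2 else 0),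
    Finset.mul_sum]
  refine Finset.sum_le_sum fun D _ => ?_
  split_ifs with hx
  swap
  · simp
  set ψ : (X → Option Y) → ℂ := fun D => if j + 1 ≤ dbRank D then 0 else φ D with hψ
  set R : ℝ := ∑ o, if j ≤ dbRank (Function.update D x o) then
    ‖φ (Function.update D x o)‖ ^ 2 else 0 with hR
  have hR0 : 0 ≤ R := Finset.sum_nonneg fun o _ => by split_ifs <;> positivity
  -- the amplitude of a single new value
  have hone : ∀ y, j + 1 ≤ dbRank (Function.update D x (some y)) →
      ‖dbRefl x ψ (Function.update D x (some y))‖ ^ 2 ≤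
        if some y ∈ (dbDom D).image D then 2 / Fintype.card Y * R else 0 := by
    intro y hy
    have h0 : ψ (Function.update D x (some y)) = 0 := by simp only [hψ, if_pos hy]
    simp only [dbRefl, h0, zero_sub, norm_neg, Function.update_self, Function.update_idem,
      norm_smul, mul_pow, Complex.norm_real, Real.norm_eq_abs, sq_abs]
    rw [dbRank_update_some hx] at hy
    split_ifs with hmem
    · rw [if_pos hmem] at hy
      have hψφ : ∀ o, ‖ψ (Function.update D x o)‖ ^ 2 ≤
          if j ≤ dbRank (Function.update D x o) then ‖φ (Function.update D x o)‖ ^ 2 else 0 := by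
        intro o
        have := dbRank_le_update hx o
        rw [if_pos (by omega)]
        simp only [hψ]
        split_ifs
        · simp
        · exact le_rfl
      -- Cauchy–Schwarz; the factor `2` is the squared norm of the reflecting vector.
      have hcs : ‖∑ o, (reflVec Y o : ℂ) • ψ (Function.update D x o)‖ ^ 2 ≤ 2 * R := by
        calc _ ≤ (∑ o, |reflVec Y o| * ‖ψ (Function.update D x o)‖) ^ 2 := by
              gcongr
              refine (norm_sum_le _ _).trans (Finset.sum_le_sum fun o _ => ?_)
              rw [norm_smul, Complex.norm_real, Real.norm_eq_abs]
          _ ≤ (∑ o, |reflVec Y o| ^ 2) * ∑ o, ‖ψ (Function.update D x o)‖ ^ 2 :=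
              Finset.sum_mul_sq_le_sq_mul_sq _ _ _
          _ ≤ 2 * R := by
              simp only [sq_abs, sum_reflVec_sq]
              exact mul_le_mul_of_nonneg_left (Finset.sum_le_sum fun o _ => hψφ o) two_pos.le
      calc _ ≤ reflVec Y (some y) ^ 2 * (2 * R) := by gcongr
        _ = 2 / Fintype.card Y * R := by
          simp only [reflVec, neg_sq, div_pow, one_pow, Real.sq_sqrt hN.le]
          ring
    -- A value not yet present leaves the rank unchanged, so the whole slice already has rank at
    -- least `j + 1`, where `ψ` vanishes.
    · rw [if_neg hmem] at hy
      have : ∀ o, ψ (Function.update D x o) = 0 := fun o => by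
        have := dbRank_le_update hx o
        simp only [hψ, if_pos (hy.trans this)]
      simp [this]
  rcases le_or_gt (dbDom D).card s with hs | hs
  · calc _ ≤ ∑ o, if o ∈ (dbDom D).image D then 2 / Fintype.card Y * R else 0 := by
          refine Finset.sum_le_sum fun o _ => ?_
          rcases o with _ | y
          · have h0 : Function.update D x none = D := by rw [← hx, Function.update_eq_self]
            have h1 : none ∉ (dbDom D).image D := by simp [dbDom]
            rw [h0, if_neg h1]
            split_ifs with hj
            · have h2 : ∀ o, ψ (Function.update D x o) = 0 := fun o => by
                have := dbRank_le_update hx o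
                simp only [hψ, if_pos (hj.trans this)]
              have h3 : ψ D = 0 := by simp only [hψ, if_pos hj]
              simp [dbRefl, h2, h3]
            · exact le_rfl
          · split_ifs with h1 h2 h2
            · simpa [h2] using hone y h1
            · simpa only [if_neg h2] using hone y h1
            · positivity
            · exact le_rfl
      _ = ((dbDom D).image D).card * (2 / Fintype.card Y * R) := by
          rw [← Finset.sum_filter, Finset.sum_const, nsmul_eq_mul, Finset.filter_univ_mem]
      _ ≤ s * (2 / Fintype.card Y * R) := by
          gcongr
          exact Finset.card_image_le.trans hs
      _ = _ := by ring
  -- With more than `s` entries besides `x`, `φ` vanishes on the whole slice.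
  · have h2 : ∀ o, ψ (Function.update D x o) = 0 := fun o => by
      have := card_dbDom_le_update hx o
      simp only [hψ, hφ _ (hs.trans_le this), ite_self]
    have h3 : ∀ o, dbRefl x ψ (Function.update D x o) = 0 := fun o => by
      simp [dbRefl, h2]
    simp only [h3, norm_zero]
    simp only [ne_eq, OfNat.ofNat_ne_zero, not_false_eq_true, zero_pow, ite_self,
      Finset.sum_const_zero]
    positivity

end Reflection

/-! ### Growth of the norm at high rank -/

section CollisionNorm

variable {X : Type u} {Y : Type v} [Fintype X] [DecidableEq X] [Fintype Y] [DecidableEq Y]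
variable {B : Type*} [Fintype B]

/-- The norm of the part of `φ` on databases with at least `j` independent collisions. -/
noncomputable def collNorm (j : ℕ) (φ : (X → Option Y) → EuclideanSpace ℂ B) : ℝ :=
  √(∑ D, if j ≤ dbRank D then ‖φ D‖ ^ 2 else 0)

theorem collNorm_nonneg (j : ℕ) (φ : (X → Option Y) → EuclideanSpace ℂ B) :
    0 ≤ collNorm j φ := Real.sqrt_nonneg _

theorem collNorm_sq (j : ℕ) (φ : (X → Option Y) → EuclideanSpace ℂ B) :
    collNorm j φ ^ 2 = ∑ D, if j ≤ dbRank D then ‖φ D‖ ^ 2 else 0 :=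
  Real.sq_sqrt (Finset.sum_nonneg fun D _ => by split_ifs <;> positivity)

theorem collNorm_sq_eq_sum (j : ℕ) (φ : (X → Option Y) → EuclideanSpace ℂ B) :
    collNorm j φ ^ 2 = ∑ b, ∑ D, if j ≤ dbRank D then ‖φ D b‖ ^ 2 else 0 := by
  rw [collNorm_sq, Finset.sum_comm]
  refine Finset.sum_congr rfl fun D _ => ?_
  split_ifs
  · exact EuclideanSpace.norm_sq_eq _
  · simp

theorem collNorm_add_le (j : ℕ) (φ ψ : (X → Option Y) → EuclideanSpace ℂ B) :
    collNorm j (φ + ψ) ≤ collNorm j φ + collNorm j ψ := by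
  have h : ∀ χ : (X → Option Y) → EuclideanSpace ℂ B, collNorm j χ =
      ‖(WithLp.toLp 2 fun D => if j ≤ dbRank D then χ D else 0 :
        PiLp 2 fun _ : X → Option Y => EuclideanSpace ℂ B)‖ := by
    intro χ
    rw [PiLp.norm_eq_of_L2, collNorm]
    congr 1
    refine Finset.sum_congr rfl fun D _ => ?_
    simp only
    split_ifs <;> simp
  rw [h, h, h]
  refine le_trans (le_of_eq ?_) (norm_add_le _ _)
  congr 1
  ext1 D
  simp only [PiLp.add_apply, Pi.add_apply]
  split_ifs <;> simp

theorem collNorm_congr {j : ℕ} {φ ψ : (X → Option Y) → EuclideanSpace ℂ B}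
    (h : ∀ D, ‖φ D‖ = ‖ψ D‖) : collNorm j φ = collNorm j ψ := by
  simp only [collNorm, h]

/-- The reflection at an entry of the database that is controlled by the basis state. -/
noncomputable def ctrlRefl (g : B → Option X) (φ : (X → Option Y) → EuclideanSpace ℂ B) :
    (X → Option Y) → EuclideanSpace ℂ B := fun D =>
  WithLp.toLp 2 fun b => dbReflList (g b).toList (fun D => φ D b) D

omit [Fintype X] [DecidableEq Y] [Fintype B] in
theorem ctrlRefl_add (g : B → Option X) (φ ψ : (X → Option Y) → EuclideanSpace ℂ B) :
    ctrlRefl g (φ + ψ) = ctrlRefl g φ + ctrlRefl g ψ := by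
  ext D b
  cases hg : g b with
  | none => simp [ctrlRefl, hg, dbReflList]
  | some x =>
    simp only [ctrlRefl, hg, Option.toList, dbReflList, Pi.add_apply, PiLp.add_apply]
    exact congrFun (dbRefl_add x (fun D => φ D b) fun D => ψ D b) D

theorem collNorm_zero_ctrlRefl [Nonempty Y] (g : B → Option X)
    (φ : (X → Option Y) → EuclideanSpace ℂ B) :
    collNorm 0 (ctrlRefl g φ) = collNorm 0 φ := by
  rw [← sq_eq_sq₀ (collNorm_nonneg _ _) (collNorm_nonneg _ _), collNorm_sq_eq_sum,
    collNorm_sq_eq_sum]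
  exact Finset.sum_congr rfl fun b _ => sum_norm_sq_dbReflList (g b).toList
    (fun D => 0 ≤ dbRank D) (by simp) (fun D => φ D b)

omit [DecidableEq Y] [Fintype B] in
theorem ctrlRefl_eq_zero_of_card_lt {φ : (X → Option Y) → EuclideanSpace ℂ B} {s : ℕ}
    (hφ : ∀ D, s < (dbDom D).card → φ D = 0) (g : B → Option X) {D : X → Option Y}
    (hD : s + 1 < (dbDom D).card) : ctrlRefl g φ D = 0 := by
  ext b
  have h : ∀ D, s < (dbDom D).card → φ D b = 0 := fun D hD => by simp [hφ D hD]
  cases hg : g b with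
  | none => simpa [ctrlRefl, hg, dbReflList] using h D (by omega)
  | some x =>
    simpa [ctrlRefl, hg, dbReflList] using
      dbRefl_eq_zero_of_card_lt (φ := fun D => φ D b) h x hD

/-- Split `φ` by rank: the part at rank at least `j + 1` keeps its total norm, and the rest enters
that region only with the small amplitude of `sum_norm_sq_dbRefl_le`. -/
theorem collNorm_succ_ctrlRefl_le [Nonempty Y] {φ : (X → Option Y) → EuclideanSpace ℂ B} {s : ℕ}
    (hφ : ∀ D, s < (dbDom D).card → φ D = 0) (g : B → Option X) (j : ℕ) :
    collNorm (j + 1) (ctrlRefl g φ) ≤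
      collNorm (j + 1) φ + √(2 * s / Fintype.card Y) * collNorm j φ := by
  set φ₁ : (X → Option Y) → EuclideanSpace ℂ B := fun D => if j + 1 ≤ dbRank D then φ D else 0
    with hφ₁
  set φ₂ : (X → Option Y) → EuclideanSpace ℂ B := fun D => if j + 1 ≤ dbRank D then 0 else φ D
    with hφ₂
  have hsum : φ = φ₁ + φ₂ := by
    ext1 D
    simp only [hφ₁, hφ₂, Pi.add_apply]
    split_ifs <;> simp
  conv_lhs => rw [hsum, ctrlRefl_add]
  refine (collNorm_add_le _ _ _).trans (add_le_add ?_ ?_)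
  · calc _ ≤ collNorm 0 (ctrlRefl g φ₁) := by
          refine Real.sqrt_le_sqrt (Finset.sum_le_sum fun D _ => ?_)
          simp only [Nat.zero_le, if_true]
          split_ifs
          · exact le_rfl
          · positivity
      _ = collNorm 0 φ₁ := collNorm_zero_ctrlRefl _ _
      _ = collNorm (j + 1) φ := by
          simp only [collNorm, Nat.zero_le, if_true, hφ₁]
          congr 1
          refine Finset.sum_congr rfl fun D _ => ?_
          split_ifs <;> simp
  · have hN : (0 : ℝ) ≤ Fintype.card Y := Nat.cast_nonneg _
    refine le_of_sq_le_sq ?_ (mul_nonneg (Real.sqrt_nonneg _) (collNorm_nonneg _ _))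
    rw [mul_pow, Real.sq_sqrt (by positivity), collNorm_sq_eq_sum, collNorm_sq_eq_sum,
      Finset.mul_sum]
    refine Finset.sum_le_sum fun b _ => ?_
    have hb : (fun D => φ₂ D b) = fun D => if j + 1 ≤ dbRank D then 0 else φ D b := by
      ext D
      simp only [hφ₂]
      split_ifs <;> simp
    cases hg : g b with
    | none =>
      refine le_trans (le_of_eq (Finset.sum_eq_zero fun D _ => ?_)) (mul_nonneg (by positivity)
        (Finset.sum_nonneg fun D _ => by split_ifs <;> positivity))
      split_ifs with h
      · have h2 : φ₂ D = 0 := if_pos h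
        simp [ctrlRefl, hg, dbReflList, h2]
      · rfl
    | some x =>
      have h : ∀ D, s < (dbDom D).card → φ D b = 0 := fun D hD => by simp [hφ D hD]
      have := sum_norm_sq_dbRefl_le h x j
      simpa only [ctrlRefl, hg, Option.toList, dbReflList, hb] using this

/-- `φ` is reached by `t` reflections, out of at most `T`: the databases have at most `t` entries,
and having many collisions has small amplitude. -/
def IsReached (T t : ℕ) (φ : (X → Option Y) → EuclideanSpace ℂ B) : Prop :=
  (∀ D, t < (dbDom D).card → φ D = 0) ∧
    ∀ j, collNorm j φ ≤ t ^ j * √(2 * T / Fintype.card Y) ^ j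

theorem IsReached.ctrlRefl [Nonempty Y] {T t : ℕ} {φ : (X → Option Y) → EuclideanSpace ℂ B}
    (h : IsReached T t φ) (ht : t ≤ T) (g : B → Option X) :
    IsReached T (t + 1) (ctrlRefl g φ) := by
  refine ⟨fun D hD => ctrlRefl_eq_zero_of_card_lt h.1 g hD, fun j => ?_⟩
  cases j with
  | zero =>
    rw [collNorm_zero_ctrlRefl]
    simpa using h.2 0
  | succ j =>
    set β := √(2 * T / Fintype.card Y) with hβ
    have hβ0 : 0 ≤ β := Real.sqrt_nonneg _
    calc _ ≤ collNorm (j + 1) φ + √(2 * t / Fintype.card Y) * collNorm j φ :=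
          collNorm_succ_ctrlRefl_le h.1 g j
      _ ≤ t ^ (j + 1) * β ^ (j + 1) + β * (t ^ j * β ^ j) := by
          gcongr
          · exact h.2 _
          · exact collNorm_nonneg _ _
          · rw [hβ]
            gcongr
          · exact h.2 _
      _ = t ^ j * (t + 1) * β ^ (j + 1) := by ring
      -- The cruder factor `t ^ j`, in place of a binomial coefficient, already closes the
      -- induction.
      _ ≤ (t + 1) ^ j * (t + 1) * β ^ (j + 1) := by
          gcongr
          linarith
      _ = _ := by push_cast; ring

theorem IsReached.of_norm_eq {T t : ℕ} {φ ψ : (X → Option Y) → EuclideanSpace ℂ B}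
    (h : IsReached T t φ) (hψ : ∀ D, ‖ψ D‖ = ‖φ D‖) : IsReached T t ψ := by
  refine ⟨fun D hD => ?_, fun j => collNorm_congr hψ ▸ h.2 j⟩
  rw [← norm_eq_zero, hψ, h.1 D hD, norm_zero]

end CollisionNorm

/-! ### Simulation by the compressed oracle -/

namespace QueryAlgorithm

variable {X : Type u} {Y : Type v} {Z : Type w} {O : Type*} [Fintype X] [DecidableEq X] [Fintype Y]
  [AddCommGroup Y] [Fintype Z]

/-- The function given by a database, with the value `0` at the undefined entries. -/
def dbFun (D : X → Option Y) : X → Y := fun x => (D x).getD 0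

/-- The joint state of the algorithm and the compressed oracle after `i` queries. -/
noncomputable def dbState (A : QueryAlgorithm X Y Z O) : ℕ → (X → Option Y) → QState X Y Z
  | 0 => fun D => dbProd ∅ D • A.init
  | i + 1 => fun D => A.step i (ctrlRefl (fun b => some b.1)
      (fun D => queryOracle Z (dbFun D) (ctrlRefl (fun b => some b.1) (A.dbState i) D)) D)

theorem isReached_dbState [DecidableEq Y] (A : QueryAlgorithm X Y Z O) {T i : ℕ}
    (hT : 2 * i ≤ T) : IsReached T (2 * i) (A.dbState i) := by
  induction i with
  | zero =>
    have h0 : ∀ D : X → Option Y, D ≠ (fun _ => none) → A.dbState 0 D = 0 := by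
      intro D hD
      obtain ⟨x, hx⟩ := Function.ne_iff.1 hD
      have : dbProd ∅ D = 0 := Finset.prod_eq_zero (Finset.mem_univ x) (by simp [hx])
      simp [dbState, this]
    have h1 : A.dbState 0 (fun _ => none) = A.init := by simp [dbState, dbProd]
    refine ⟨fun D hD => h0 D ?_, fun j => ?_⟩
    · rintro rfl
      simp [dbDom] at hD
    · have h2 : collNorm j (A.dbState 0) ^ 2 = if j = 0 then 1 else 0 := by
        rw [collNorm_sq, Finset.sum_eq_single (fun _ => none)]
        · simp [h1, A.norm_init, dbRank, dbDom]
        · intro D _ hD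
          simp [h0 D hD]
        · simp
      rcases eq_or_ne j 0 with rfl | hj
      · rw [if_pos rfl, pow_eq_one_iff_of_nonneg (collNorm_nonneg _ _) two_ne_zero] at h2
        simp [h2]
      · rw [if_neg hj, sq_eq_zero_iff] at h2
        simp [h2, hj]
  | succ i ih =>
    -- A query costs two reflections; the oracle call and the unitary preserve the norm for each
    -- database.
    exact ((((ih (by omega)).ctrlRefl (by omega) (fun b => some b.1)).of_norm_eq
      fun D => LinearIsometryEquiv.norm_map _ _).ctrlRefl (by omega) (fun b => some b.1)).of_norm_eq
      fun D => LinearIsometryEquiv.norm_map _ _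

omit [DecidableEq X] in
theorem queryOracle_apply (f : X → Y) (ψ : QState X Y Z) (b : X × Y × Z) :
    queryOracle Z f ψ b = ψ (b.1, b.2.1 - f b.1, b.2.2) := rfl

omit [Fintype X] [AddCommGroup Y] in
theorem dbReflList_apply {B : Type*} [Fintype B] (l : List X)
    (φ : (X → Option Y) → EuclideanSpace ℂ B) (D : X → Option Y) (b : B) :
    dbReflList l φ D b = dbReflList l (fun D => φ D b) D :=
  (congrFun (dbReflList_map (EuclideanSpace.proj b : EuclideanSpace ℂ B →L[ℂ] ℂ).toLinearMap l φ)
    D).symm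

/-- Decompressing the database gives the state of the algorithm with the oracle in uniform
superposition. -/
theorem dbReflList_dbState (A : QueryAlgorithm X Y Z O) (i : ℕ) (D : X → Option Y) :
    dbReflList Finset.univ.toList (A.dbState i) D =
      dbProd Finset.univ D • A.state (dbFun D) i := by
  induction i generalizing D with
  | zero =>
    have := dbReflList_map (LinearMap.toSpanSingleton ℂ (QState X Y Z) A.init)
      (Finset.univ : Finset X).toList (dbProd (Y := Y) ∅)
    rw [dbReflList_univ_dbProd_empty] at this
    exact congrFun this D
  | succ i ih =>
    have h1 := congrFun (dbReflList_map (A.step i).toLinearEquiv.toLinearMap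
      (Finset.univ : Finset X).toList (ctrlRefl (fun b => some b.1) (fun D =>
        queryOracle Z (dbFun D) (ctrlRefl (fun b => some b.1) (A.dbState i) D)))) D
    refine h1.trans ?_
    change A.step i _ = dbProd _ D • A.step i _
    rw [← map_smul]
    congr 1
    ext b
    rw [dbReflList_apply]
    change dbReflList _ (dbRefl b.1 fun D' => queryOracle Z (dbFun D')
      (ctrlRefl (fun b => some b.1) (A.dbState i) D') b) D = _
    -- The outer reflection at the queried input cancels. The remaining ones leave the queried value
    -- fixed and pass the query, and the inner reflection then completes the decompression.
    rw [dbReflList_univ_dbRefl]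
    simp only [queryOracle_apply]
    have h2 := congrFun (dbReflList_param (Finset.univ.erase b.1).toList
      (fun D : X → Option Y => dbFun D b.1) (fun x hx D o => by
        have : b.1 ≠ x := by rintro rfl; simp at hx
        simp [dbFun, this])
      (fun y D' => ctrlRefl (fun b => some b.1) (A.dbState i) D' (b.1, b.2.1 - y, b.2.2))) D
    refine h2.trans ?_
    change dbReflList _ (dbRefl b.1 fun D' => A.dbState i D' (b.1, b.2.1 - dbFun D b.1, b.2.2)) D
      = _
    rw [dbReflList_erase_dbRefl, ← dbReflList_apply, ih]
    rfl

end QueryAlgorithm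

/-! ### Checking the output on the database -/

section Check

variable {X : Type u} {Y : Type v} [Fintype X] [DecidableEq X] [Fintype Y]
variable {B : Type*} [Fintype B]

/-- Reflections at the first `t` entries of the list `W b`, which depends on the basis state `b`. -/
noncomputable def ctrlReflList (W : B → List X) (φ : (X → Option Y) → EuclideanSpace ℂ B) :
    ℕ → (X → Option Y) → EuclideanSpace ℂ B
  | 0 => φ
  | t + 1 => ctrlRefl (fun b => (W b)[t]?) (ctrlReflList W φ t)

omit [Fintype X] [Fintype B] in
theorem ctrlReflList_apply (W : B → List X) (φ : (X → Option Y) → EuclideanSpace ℂ B) (t : ℕ)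
    (D : X → Option Y) (b : B) :
    ctrlReflList W φ t D b = dbReflList ((W b).take t) (fun D => φ D b) D := by
  induction t generalizing D with
  | zero => simp [ctrlReflList, dbReflList]
  | succ t ih =>
    simp only [ctrlReflList, ctrlRefl, List.take_add_one, dbReflList_append, ih]

theorem IsReached.ctrlReflList [DecidableEq Y] [Nonempty Y] {T s : ℕ}
    {φ : (X → Option Y) → EuclideanSpace ℂ B} (h : IsReached T s φ) (W : B → List X) {t : ℕ}
    (ht : s + t ≤ T) : IsReached T (s + t) (ctrlReflList W φ t) := by
  induction t with
  | zero => exact h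
  | succ t ih => exact (ih (by omega)).ctrlRefl (by omega) _

/-- The vertices of the edges in `E`. -/
def edgeVerts (E : Finset (Sym2 X)) : Finset X := E.biUnion Sym2.toFinset

omit [Fintype X] in
theorem card_edgeVerts_le (E : Finset (Sym2 X)) : (edgeVerts E).card ≤ 2 * E.card := by
  rw [mul_comm]
  refine Finset.card_biUnion_le_card_mul _ _ _ fun e _ => ?_
  rw [Sym2.card_toFinset]
  split_ifs <;> omega

/-- The database `D` shows that `E` is a family of `j` independent collisions. -/
def IsRecorded (j : ℕ) (E : Finset (Sym2 X)) (D : X → Option Y) : Prop :=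
  E.card = j ∧ (∀ e ∈ E, ¬ e.IsDiag) ∧
    (SimpleGraph.fromEdgeSet (E : Set (Sym2 X))).IsAcyclic ∧
    ∀ a b, s(a, b) ∈ E → D a = D b ∧ D a ≠ none

omit [Fintype X] [DecidableEq X] [Fintype Y] in
theorem IsTwoCollisionFamily.isRecorded {j : ℕ} {E : Finset (Sym2 X)} {f : X → Y}
    (h : IsTwoCollisionFamily j f E) : IsRecorded j E fun x => some (f x) := by
  refine ⟨h.1, fun e he => ?_, h.2.2, fun a b hab => ?_⟩
  · obtain ⟨x, x', hne, -, rfl⟩ := h.2.1 e he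
    simpa using hne
  · obtain ⟨x, x', -, hf, he⟩ := h.2.1 _ hab
    rcases Sym2.eq_iff.1 he with ⟨rfl, rfl⟩ | ⟨rfl, rfl⟩
    · simp [hf]
    · simp [hf]

omit [Fintype X] [Fintype Y] in
theorem isRecorded_update_iff {j : ℕ} {E : Finset (Sym2 X)} {x : X} (hx : x ∉ edgeVerts E)
    (D : X → Option Y) (o : Option Y) :
    IsRecorded j E (Function.update D x o) ↔ IsRecorded j E D := by
  refine and_congr_right fun _ => and_congr_right fun _ => and_congr_right fun _ =>
    forall_congr' fun a => forall_congr' fun b => forall_congr' fun hab => ?_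
  have ha : a ≠ x := by
    rintro rfl; exact hx (Finset.mem_biUnion.2 ⟨_, hab, by simp⟩)
  have hb : b ≠ x := by
    rintro rfl; exact hx (Finset.mem_biUnion.2 ⟨_, hab, by simp⟩)
  rw [Function.update_of_ne ha, Function.update_of_ne hb]

omit [Fintype Y] in
theorem IsRecorded.le_dbRank [DecidableEq Y] {j : ℕ} {E : Finset (Sym2 X)} {D : X → Option Y}
    (h : IsRecorded j E D) : j ≤ dbRank D :=
  h.1 ▸ le_dbRank_of_isAcyclic D E h.2.1 h.2.2.1 h.2.2.2

open scoped Classical in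
/-- To see whether the database records the collisions in `E`, it suffices to decompress the
entries at the vertices of `E`. -/
theorem sum_isRecorded_le [Nonempty Y] (j : ℕ) (E : Finset (Sym2 X))
    (φ : (X → Option Y) → ℂ) :
    (∑ D, if IsRecorded j E D then ‖dbReflList Finset.univ.toList φ D‖ ^ 2 else 0) ≤
      ∑ D, if j ≤ dbRank D then ‖dbReflList ((edgeVerts E).toList.take (2 * j)) φ D‖ ^ 2
        else 0 := by
  by_cases hE : E.card = j
  -- Being recorded depends only on entries at vertices of `E`, so the reflections at all other
  -- inputs are dropped without changing the weight. For `E.card = j` the truncation to `2 * j`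
  -- vertices is void; it only keeps the number of reflections bounded for other outputs.
  · have hperm : (Finset.univ : Finset X).toList.Perm
        ((edgeVerts E).toList ++ (edgeVerts E)ᶜ.toList) := by
      rw [List.perm_ext_iff_of_nodup (Finset.nodup_toList _)]
      · intro a
        simp [em]
      · refine List.nodup_append.2 ⟨Finset.nodup_toList _, Finset.nodup_toList _, ?_⟩
        rintro a ha b hb rfl
        simp at ha hb
        exact hb ha
    have htake : (edgeVerts E).toList.take (2 * j) = (edgeVerts E).toList :=
      List.take_of_length_le (by simpa [hE] using card_edgeVerts_le E)
    rw [htake, dbReflList_perm hperm, dbReflList_append, sum_norm_sq_dbReflList _ (IsRecorded j E)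
      fun x hx => isRecorded_update_iff (by simpa using hx)]
    refine Finset.sum_le_sum fun D _ => ?_
    split_ifs with h1 h2 h2
    · exact le_rfl
    · exact absurd h1.le_dbRank h2
    · positivity
    · exact le_rfl
  · have : ∀ D : X → Option Y, ¬ IsRecorded j E D := fun D h => hE h.1
    simp only [this, if_false, Finset.sum_const_zero]
    exact Finset.sum_nonneg fun D _ => by split_ifs <;> positivity

end Check

/-! ### Success probability and the final bound -/

namespace QueryAlgorithm

variable {X : Type u} {Y : Type v} {Z : Type w} [Fintype X] [DecidableEq X] [Fintype Y]
  [AddCommGroup Y] [Fintype Z]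

omit [AddCommGroup Y] in
theorem norm_sq_dbProd_univ_some (f : X → Y) :
    ‖dbProd Finset.univ (fun x => some (f x))‖ ^ 2 = 1 / (Fintype.card (X → Y) : ℝ) := by
  simp only [dbProd, Finset.mem_univ, if_true, uniformVec, Finset.prod_const, Finset.card_univ,
    norm_pow, Complex.norm_real, Real.norm_eq_abs, Fintype.card_fun, Nat.cast_pow]
  rw [← pow_mul, mul_comm, pow_mul, sq_abs, div_pow, Real.sq_sqrt (Nat.cast_nonneg _)]
  simp

theorem norm_sq_dbReflList_dbState_some (A : QueryAlgorithm X Y Z (Finset (Sym2 X))) (i : ℕ)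
    (f : X → Y) (b : X × Y × Z) :
    ‖dbReflList Finset.univ.toList (fun D => A.dbState i D b) (fun x => some (f x))‖ ^ 2 =
      ‖A.state f i b‖ ^ 2 / Fintype.card (X → Y) := by
  rw [← dbReflList_apply, dbReflList_dbState, PiLp.smul_apply, norm_smul, mul_pow,
    norm_sq_dbProd_univ_some]
  have : dbFun (fun x => some (f x)) = f := by ext; simp [dbFun]
  rw [this]
  ring

/-- After full decompression, the database of a total function `f` carries the state of the run with
`f`, weighted by the probability of `f`. Success is thus bounded by the weight of the databases that
record the output. -/
theorem successProb_le_collNorm_sq [DecidableEq Y]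
    (A : QueryAlgorithm X Y Z (Finset (Sym2 X))) (i j : ℕ) :
    A.successProb i (IsTwoCollisionFamily j) ≤
      collNorm j (ctrlReflList (fun b => (edgeVerts (A.output b)).toList) (A.dbState i)
        (2 * j)) ^ 2 := by
  classical
  rw [collNorm_sq_eq_sum]
  simp only [successProb, outputProb, ctrlReflList_apply]
  rw [Finset.sum_comm, Finset.sum_div]
  refine Finset.sum_le_sum fun b _ => ?_
  set E := A.output b
  set φ : (X → Option Y) → ℂ := fun D => A.dbState i D b with hφ
  set h : (X → Option Y) → ℝ := fun D =>
    if IsRecorded j E D then ‖dbReflList Finset.univ.toList φ D‖ ^ 2 else 0 with hh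
  have h0 : ∀ D, 0 ≤ h D := fun D => by
    simp only [hh]; split_ifs <;> positivity
  let emb : (X → Y) ↪ (X → Option Y) := ⟨fun f x => some (f x), fun f g hfg => by
    ext x; exact Option.some_injective _ (congrFun hfg x)⟩
  calc _ ≤ ∑ f : X → Y, h (emb f) := by
        rw [Finset.sum_div]
        refine Finset.sum_le_sum fun f _ => ?_
        split_ifs with hR
        · have h1 : h (emb f) = ‖dbReflList Finset.univ.toList φ (emb f)‖ ^ 2 :=
            if_pos (IsTwoCollisionFamily.isRecorded hR)
          rw [h1]
          exact (norm_sq_dbReflList_dbState_some A i f b).ge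
        · simpa using h0 _
    _ = ∑ D ∈ Finset.univ.map emb, h D := (Finset.sum_map _ _ _).symm
    _ ≤ ∑ D, h D := Finset.sum_le_univ_sum_of_nonneg h0
    _ ≤ _ := by convert sum_isRecorded_le j E φ

end QueryAlgorithm

theorem mainTheorem8 (j : ℕ) :
    ∃ C : ℝ, 0 < C ∧
      ∀ (X : Type u) (Y : Type v) (Z : Type w) [Fintype X] [DecidableEq X] [Fintype Y]
        [AddCommGroup Y] [Fintype Z] (A : QueryAlgorithm X Y Z (Finset (Sym2 X))) (i : ℕ),
        1 ≤ i →
          A.successProb i (IsTwoCollisionFamily j) ≤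
            C * ((i : ℝ) ^ 3 / (Fintype.card Y : ℝ)) ^ j := by
  -- From `2 * T ^ 3` with `T = 2 * i + 2 * j ≤ (2 + 2 * j) * i`, which uses `1 ≤ i`.
  refine ⟨(2 * (2 + 2 * (j : ℝ)) ^ 3) ^ j, by positivity, ?_⟩
  intro X Y Z _ _ _ _ _ A i hi
  classical
  have hreach := (A.isReached_dbState (T := 2 * i + 2 * j) (i := i) (by omega)).ctrlReflList
    (fun b => (edgeVerts (A.output b)).toList) le_rfl
  have hT : ((2 * i + 2 * j : ℕ) : ℝ) ≤ (2 + 2 * j) * i := by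
    have h1 : (1 : ℝ) ≤ i := by exact_mod_cast hi
    push_cast
    nlinarith [mul_nonneg (Nat.cast_nonneg (α := ℝ) j) (sub_nonneg.2 h1)]
  set T : ℝ := ((2 * i + 2 * j : ℕ) : ℝ) with hTdef
  have hT0 : 0 ≤ T := Nat.cast_nonneg _
  calc _ ≤ _ := A.successProb_le_collNorm_sq i j
    _ ≤ (T ^ j * √(2 * T / Fintype.card Y) ^ j) ^ 2 :=
        pow_le_pow_left₀ (collNorm_nonneg _ _) (hreach.2 j) 2
    _ = (2 * T ^ 3 / Fintype.card Y) ^ j := by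
        rw [← mul_pow, ← pow_mul, mul_comm j, pow_mul, mul_pow, Real.sq_sqrt (by positivity)]
        congr 1
        ring
    _ ≤ (2 * ((2 + 2 * j) * i) ^ 3 / Fintype.card Y) ^ j := by gcongr
    _ = _ := by
        rw [← mul_pow]
        congr 1
        ring
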